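/- Let $\kappa>1$ be an integer, let $A=(a_{ij})$ be an $m\times n$ integer matrix, and let $$X=\Bigl\{x=(\xi_1,\dots,\xi_n)\in(\mathbb Z/\kappa\mathbb Z)^n:\ \sum_{j=1}^n a_{ij}\xi_j\equiv 0 \bmod \kappa\ \text{ for } i=1,\dots,m\Bigr\}.$$ For $w_1,\dots,w_n\in\mathbb C$ define the weight of $x=(\xi_1,\dots,\xi_n)\in(\mathbb Z/\kappa\mathbb Z)^n$ by $w(x)=\prod_{j:\,\xi_j\ne 0}w_j$ (so that $w(0)=1$) and the weight of $X$ by $w(X)=\sum_{x\in X}w(x)$. Let $r\ge 2$ and $c\ge 1$ be integers such that every row of $A$ has at most $r$ non-zero entries and every column of $A$ has at most $c$ non-zero entries. If $$|w_j|\le \frac{0.46}{(\kappa-1)\,r\sqrt c}\qquad\text{for } j=1,\dots,n,$$ then $w(X)\ne 0$. In particular, let $p$ be a prime, let $A$ be an $m\times n$ matrix over the field $\mathbb F_p$ with at most $r\ge 2$ non-zero entries in every row and at most $c\ge 1$ non-zero entries in every column, and let $X=\{x\in\mathbb F_p^n: Ax=0\}$ be the linear code with parity check matrix $A$. Then the weight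 enumerator $p_X(z)=1+\sum_{k=1}^n p_k(X)z^k$, where $p_k(X)$ is the number of vectors in $X$ with exactly $k$ non-zero coordinates, satisfies $p_X(z)\ne 0$ for all $z\in\mathbb C$ with $|z|\le \dfrac{0.46}{(p-1)\,r\sqrt c}$. -/

import Mathlib

/-- The number of non-zero entries in every row of `A` does not exceed `r`. -/
def RowSparse {m n : ℕ} {R : Type*} [Zero R] (A : Matrix (Fin m) (Fin n) R) (r : ℕ) : Prop :=
  ∀ i, {j | A i j ≠ 0}.ncard ≤ r

/-- The number of non-zero entries in every column of `A` does not exceed `c`. -/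
def ColSparse {m n : ℕ} {R : Type*} [Zero R] (A : Matrix (Fin m) (Fin n) R) (c : ℕ) : Prop :=
  ∀ j, {i | A i j ≠ 0}.ncard ≤ c

/-- The set of `x ∈ (ℤ/κℤ)ⁿ` with `∑ⱼ aᵢⱼ ξⱼ ≡ 0 mod κ` for every row `i` of the integer matrix. -/
def solutionSet (κ : ℕ) {m n : ℕ} (A : Matrix (Fin m) (Fin n) ℤ) : Set (Fin n → ZMod κ) :=
  {x | ∀ i, ∑ j, (A i j : ZMod κ) * x j = 0}

/-- The weight of a vector: the product of the `w j` over the `j` with `x j ≠ 0`. -/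
noncomputable def vecWeight {κ n : ℕ} (w : Fin n → ℂ) (x : Fin n → ZMod κ) : ℂ :=
  ∏ j with x j ≠ 0, w j

/-- The weight of a set of vectors: the sum of the weights of its elements
(for `0 < κ` every set of vectors is finite). -/
noncomputable def setWeight {κ n : ℕ} (w : Fin n → ℂ) (X : Set (Fin n → ZMod κ)) : ℂ :=
  ∑ᶠ x ∈ X, vecWeight w x

/-- The linear code `{x ∈ 𝔽_pⁿ : A x = 0}` with parity check matrix `A`. -/
def parityCheckCode {p m n : ℕ} (A : Matrix (Fin m) (Fin n) (ZMod p)) :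
    Submodule (ZMod p) (Fin n → ZMod p) :=
  LinearMap.ker A.mulVecLin

/-- The weight enumerator `1 + ∑_{k=1}^n p_k(X) z^k` of a code `X`, where `p_k(X)` is the number
of vectors in `X` with exactly `k` non-zero coordinates. -/
noncomputable def weightEnumerator {p n : ℕ} (X : Set (Fin n → ZMod p)) : Polynomial ℂ :=
  1 + ∑ k ∈ Finset.Icc 1 n,
    Polynomial.C (({x | x ∈ X ∧ hammingNorm x = k}.ncard : ℕ) : ℂ) * Polynomial.X ^ k

/-! Expanding the indicator of $X$ in additive characters turns $\kappa^m w(X)$ into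
$\sum_l\prod_j(1+g_j(l))$ with $|g_j|\le 0.46/(r\sqrt c)$ (`pow_mul_setWeight_solutionSet`). Here
$g_j$ depends only on the at most $c$ coordinates $l_i$ with $a_{ij}\ne0$, and each $l_i$ enters at
most $r$ factors.

Write the product as $\exp\sum_j f_j$. Sums over faces of the product space are shown to be non-zero
by induction on the set of free coordinates (`faceSum_exp_ne_zero`). When a face is split along
coordinate $i$, scaling the $f_j$ that involve $i$ by $t\in[0,1]$ joins every part to one common
vector. By induction the logarithmic derivative along this path is at most $\alpha$: each of the $r$
terms loses at most $(\cos\alpha)^{-(c-1)}$ (`norm_faceSum_mul_le`). So all parts lie within angle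
$\alpha<\pi/2$ of that vector and cannot cancel. The choice $\alpha=0.8/\sqrt c$ keeps
$\cos^{c-1}\alpha$ bounded below. -/

/-- If `φ` is a path in `ℂ \ {0}` whose logarithmic derivative has norm at most `α`, then the angle
between its endpoints is at most `α`. -/
theorem cos_mul_norm_mul_norm_le_re_of_norm_deriv_le {φ φ' : ℝ → ℂ} {α : ℝ} (hα : α ≤ Real.pi)
    (hφ : ∀ t, HasDerivAt φ (φ' t) t) (hc : Continuous φ')
    (h0 : ∀ t ∈ Set.Icc (0 : ℝ) 1, φ t ≠ 0)
    (hb : ∀ t ∈ Set.Icc (0 : ℝ) 1, ‖φ' t‖ ≤ α * ‖φ t‖) :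
    Real.cos α * (‖φ 1‖ * ‖φ 0‖) ≤ (φ 1 * (starRingEnd ℂ) (φ 0)).re := by
  have hcφ : Continuous φ := continuous_iff_continuousAt.2 fun t => (hφ t).continuousAt
  have hq : ContinuousOn (fun t => φ' t / φ t) (Set.Icc 0 1) := hc.continuousOn.div hcφ.continuousOn h0
  -- A logarithm of `φ t / φ 0`; the imaginary part of `g 1` is the angle swept.
  set g : ℝ → ℂ := fun t => ∫ s in (0 : ℝ)..t, φ' s / φ s with hg
  have hgc : ContinuousOn g (Set.Icc 0 1) := by
    have := intervalIntegral.continuousOn_primitive_interval' (μ := MeasureTheory.volume)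
      (f := fun t => φ' t / φ t) (a := 0) (b₁ := 0) (b₂ := 1)
      (by rw [← Set.uIcc_of_le zero_le_one] at hq; exact hq.intervalIntegrable) (by simp)
    rwa [Set.uIcc_of_le zero_le_one] at this
  have hgd : ∀ t ∈ Set.Ioo (0 : ℝ) 1, HasDerivAt g (φ' t / φ t) t := by
    intro t ht
    have hca : ContinuousAt (fun t => φ' t / φ t) t :=
      hc.continuousAt.div hcφ.continuousAt (h0 t ⟨ht.1.le, ht.2.le⟩)
    refine intervalIntegral.integral_hasDerivAt_right ?_ ?_ hca
    · refine ContinuousOn.intervalIntegrable (hq.mono ?_)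
      rw [Set.uIcc_of_le ht.1.le]
      exact Set.Icc_subset_Icc_right ht.2.le
    · exact (hq.mono Set.Ioo_subset_Icc_self).stronglyMeasurableAtFilter isOpen_Ioo t ht
  have hconst : φ 1 * Complex.exp (-g 1) = φ 0 * Complex.exp (-g 0) := by
    have h := intervalIntegral.integral_eq_sub_of_hasDerivAt_of_le (a := 0) (b := 1)
      (f := fun t => φ t * Complex.exp (-g t)) (f' := fun _ => 0) zero_le_one
      (hcφ.continuousOn.mul hgc.neg.cexp) (fun t ht => by
        have hdiv : φ t * (φ' t / φ t) = φ' t := mul_div_cancel₀ _ (h0 t ⟨ht.1.le, ht.2.le⟩)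
        refine ((hφ t).fun_mul (hgd t ht).fun_neg.cexp).congr_deriv ?_
        linear_combination -Complex.exp (-g t) * hdiv) intervalIntegrable_const
    rw [intervalIntegral.integral_zero] at h
    exact sub_eq_zero.1 h.symm
  have hg0 : g 0 = 0 := by simp [hg]
  have h1 : φ 1 = φ 0 * Complex.exp (g 1) := by
    rw [hg0] at hconst
    simp only [neg_zero, Complex.exp_zero, mul_one] at hconst
    rw [← hconst, mul_assoc, ← Complex.exp_add]
    simp
  have hn : ‖g 1‖ ≤ α := by
    have := intervalIntegral.norm_integral_le_of_norm_le_const (a := 0) (b := 1) (C := α)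
      (f := fun t => φ' t / φ t) (by
        intro t ht
        rw [Set.uIoc_of_le zero_le_one] at ht
        have ht' : t ∈ Set.Icc (0 : ℝ) 1 := ⟨ht.1.le, ht.2⟩
        rw [norm_div, div_le_iff₀ (norm_pos_iff.2 (h0 t ht'))]
        exact hb t ht')
    simpa using this
  have him : |(g 1).im| ≤ α := (Complex.abs_im_le_norm _).trans hn
  have hcos : Real.cos α ≤ Real.cos (g 1).im := by
    rw [← Real.cos_abs (g 1).im]
    exact Real.cos_le_cos_of_nonneg_of_le_pi (abs_nonneg _) hα him
  have : φ 1 * (starRingEnd ℂ) (φ 0) = ((‖φ 0‖ ^ 2 : ℝ) : ℂ) * Complex.exp (g 1) := by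
    rw [h1, mul_right_comm, Complex.mul_conj, Complex.normSq_eq_norm_sq]
  rw [this, Complex.re_ofReal_mul, Complex.exp_re, h1, norm_mul, Complex.norm_exp]
  have : 0 ≤ ‖φ 0‖ ^ 2 * Real.exp (g 1).re := by positivity
  nlinarith [mul_le_mul_of_nonneg_left hcos this]

/-! ### Sums over faces of a product space -/

section Face

variable {ι Ω : Type*} [Fintype ι] [DecidableEq ι] [Fintype Ω] [DecidableEq Ω]

/-- The sum of `h` over the face through `x` on which the coordinates in `S` are free. -/
noncomputable def faceSum (S : Finset ι) (h : (ι → Ω) → ℂ) (x : ι → Ω) : ℂ :=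
  ∑ y with ∀ i, i ∉ S → y i = x i, h y

theorem faceSum_empty (h : (ι → Ω) → ℂ) (x : ι → Ω) : faceSum ∅ h x = h x := by
  have : ({y | ∀ i, i ∉ (∅ : Finset ι) → y i = x i} : Finset (ι → Ω)) = {x} := by
    ext y
    simp [funext_iff]
  rw [faceSum, this, Finset.sum_singleton]

theorem faceSum_univ (h : (ι → Ω) → ℂ) (x : ι → Ω) : faceSum Finset.univ h x = ∑ y, h y := by
  simp [faceSum]

theorem faceSum_eq_sum_erase {S : Finset ι} {i : ι} (hi : i ∈ S) (h : (ι → Ω) → ℂ) (x : ι → Ω) :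
    faceSum S h x = ∑ a, faceSum (S.erase i) h (Function.update x i a) := by
  unfold faceSum
  rw [← Finset.sum_fiberwise _ (fun y : ι → Ω => y i)]
  refine Finset.sum_congr rfl fun a _ => Finset.sum_congr ?_ fun _ _ => rfl
  ext y
  simp only [Finset.mem_filter, Finset.mem_univ, true_and, Finset.mem_erase]
  constructor
  · rintro ⟨h1, h2⟩ k hk
    by_cases hki : k = i
    · subst hki; simpa using h2
    · rw [Function.update_of_ne hki]
      exact h1 k fun hkS => hk ⟨hki, hkS⟩
  · intro h1
    refine ⟨fun k hk => ?_, ?_⟩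
    · have hki : k ≠ i := fun e => hk (e ▸ hi)
      have := h1 k fun hk' => hk hk'.2
      rwa [Function.update_of_ne hki] at this
    · simpa using h1 i (by simp)

/-- This makes the comparison vector at `t = 0` the same for every value of the split coordinate. -/
theorem faceSum_update_of_dependsOn {S : Finset ι} {i : ι} (hi : i ∉ S) {h : (ι → Ω) → ℂ}
    (hh : DependsOn h {i}ᶜ) (x : ι → Ω) (a : Ω) :
    faceSum S h (Function.update x i a) = faceSum S h x := by
  unfold faceSum
  refine Finset.sum_bij' (fun y _ => Function.update y i (x i)) (fun y _ => Function.update y i a)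
    ?_ ?_ ?_ ?_ ?_
  · intro y hy
    simp only [Finset.mem_filter, Finset.mem_univ, true_and] at hy ⊢
    intro k hk
    by_cases hki : k = i
    · subst hki; simp
    · simpa [hki] using hy k hk
  · intro y hy
    simp only [Finset.mem_filter, Finset.mem_univ, true_and] at hy ⊢
    intro k hk
    by_cases hki : k = i
    · subst hki; simp
    · simpa [hki] using hy k hk
  · intro y hy
    simp only [Finset.mem_filter, Finset.mem_univ, true_and] at hy
    have := hy i hi
    simp only [Function.update_self] at this
    simp [← this]
  · intro y hy
    simp only [Finset.mem_filter, Finset.mem_univ, true_and] at hy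
    simp [← hy i hi]
  · intro y _
    refine hh fun k hk => ?_
    rw [Function.update_of_ne (by simpa using hk)]

theorem faceSum_sum {J : Type*} (T : Finset J) (S : Finset ι) (h : J → (ι → Ω) → ℂ) (x : ι → Ω) :
    faceSum S (fun y => ∑ j ∈ T, h j y) x = ∑ j ∈ T, faceSum S (h j) x :=
  Finset.sum_comm

/-- A factor that depends on the coordinates in `I` only changes the sum over a face by a bounded
factor, provided that the sums over faces are not much smaller than the sums of their parts. -/
theorem norm_faceSum_mul_le {C ρ : ℝ} (hC : 0 < C) (hρ : 0 ≤ ρ) {h g : (ι → Ω) → ℂ} {I : Finset ι}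
    (hg : DependsOn g I) (hgρ : ∀ y, ‖g y‖ ≤ ρ) (S : Finset ι)
    (hS : ∀ T ⊆ S, ∀ i ∈ T, ∀ x : ι → Ω,
      C * ∑ a, ‖faceSum (T.erase i) h (Function.update x i a)‖ ≤ ‖faceSum T h x‖) (x : ι → Ω) :
    ‖faceSum S (fun y => g y * h y) x‖ ≤ ρ * (C ^ (I ∩ S).card)⁻¹ * ‖faceSum S h x‖ := by
  induction S using Finset.strongInduction generalizing x with
  | H S ih =>
    -- If no coordinate of `I` is free, `g` is constant on the face; otherwise fixing one such
    -- coordinate costs a factor `C⁻¹`.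
    rcases (I ∩ S).eq_empty_or_nonempty with he | ⟨i, hi⟩
    · have : faceSum S (fun y => g y * h y) x = g x * faceSum S h x := by
        unfold faceSum
        rw [Finset.mul_sum]
        refine Finset.sum_congr rfl fun y hy => ?_
        simp only [Finset.mem_filter, Finset.mem_univ, true_and] at hy
        beta_reduce
        rw [hg fun k hk => hy k fun hkS => ?_]
        have : k ∈ I ∩ S := Finset.mem_inter.2 ⟨hk, hkS⟩
        simp [he] at this
      rw [this, he, norm_mul]
      simpa using mul_le_mul_of_nonneg_right (hgρ x) (norm_nonneg _)
    · obtain ⟨hiI, hiS⟩ := Finset.mem_inter.1 hi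
      have hcard : (I ∩ S).card = (I ∩ S.erase i).card + 1 := by
        rw [Finset.inter_erase, Finset.card_erase_add_one hi]
      rw [faceSum_eq_sum_erase hiS]
      calc ‖∑ a, faceSum (S.erase i) (fun y => g y * h y) (Function.update x i a)‖
          ≤ ∑ a, ‖faceSum (S.erase i) (fun y => g y * h y) (Function.update x i a)‖ :=
            norm_sum_le _ _
        _ ≤ ∑ a, ρ * (C ^ (I ∩ S.erase i).card)⁻¹ *
              ‖faceSum (S.erase i) h (Function.update x i a)‖ :=
            Finset.sum_le_sum fun a _ => ih _ (Finset.erase_ssubset hiS)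
              (fun T hT => hS T (hT.trans (Finset.erase_subset _ _))) _
        _ = ρ * (C ^ (I ∩ S).card)⁻¹ *
              (C * ∑ a, ‖faceSum (S.erase i) h (Function.update x i a)‖) := by
            rw [← Finset.mul_sum, hcard, pow_succ]
            field_simp
        _ ≤ _ := by
            gcongr
            exact hS S subset_rfl i hiS x

end Face

/-- If all vectors `u a` make an angle at most `α` with a fixed non-zero vector, then there is
little cancellation in their sum. -/
theorem cos_mul_sum_norm_le_norm_sum {Ω : Type*} [Fintype Ω] {C : ℝ} {u : Ω → ℂ} {v : ℂ} (hv : v ≠ 0)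
    (hu : ∀ a, C * (‖u a‖ * ‖v‖) ≤ (u a * (starRingEnd ℂ) v).re) :
    C * ∑ a, ‖u a‖ ≤ ‖∑ a, u a‖ := by
  have hv' : 0 < ‖v‖ := norm_pos_iff.2 hv
  refine le_of_mul_le_mul_right ?_ hv'
  calc C * (∑ a, ‖u a‖) * ‖v‖ = ∑ a, C * (‖u a‖ * ‖v‖) := by
        rw [← Finset.mul_sum, ← Finset.sum_mul, mul_assoc]
    _ ≤ ∑ a, (u a * (starRingEnd ℂ) v).re := Finset.sum_le_sum fun a _ => hu a
    _ = ((∑ a, u a) * (starRingEnd ℂ) v).re := by rw [Finset.sum_mul, Complex.re_sum]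
    _ ≤ ‖(∑ a, u a) * (starRingEnd ℂ) v‖ := Complex.re_le_norm _
    _ = ‖∑ a, u a‖ * ‖v‖ := by rw [norm_mul, Complex.norm_conj]

/-! ### Non-vanishing by induction on faces -/

section NonVanishing

variable {ι Ω J : Type*} [Fintype ι] [DecidableEq ι] [Fintype Ω] [DecidableEq Ω] [Fintype J]

/-- Sums over faces of the exponential of a sum of small functions, each depending on at most `c`
coordinates, do not vanish, and there is little cancellation when a face is split. -/
theorem faceSum_exp_ne_zero [Nonempty Ω] {I : J → Finset ι} {ρ : J → ℝ} {c : ℕ} {α L : ℝ}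
    (hα : α < Real.pi / 2) (hα0 : 0 ≤ α) (hI : ∀ j, (I j).card ≤ c)
    (hL : ∀ i, ∑ j with i ∈ I j, ρ j ≤ L) (hLα : L ≤ α * Real.cos α ^ (c - 1))
    (hρ : ∀ j, 0 ≤ ρ j) (S : Finset ι) (f : J → (ι → Ω) → ℂ)
    (hf : ∀ j, DependsOn (f j) (I j)) (hfρ : ∀ j y, ‖f j y‖ ≤ ρ j) (x : ι → Ω) :
    faceSum S (fun y => Complex.exp (∑ j, f j y)) x ≠ 0 ∧
      ∀ i ∈ S, Real.cos α * ∑ a, ‖faceSum (S.erase i) (fun y => Complex.exp (∑ j, f j y))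
        (Function.update x i a)‖ ≤ ‖faceSum S (fun y => Complex.exp (∑ j, f j y)) x‖ := by
  have hC : 0 < Real.cos α := Real.cos_pos_of_mem_Ioo ⟨by linarith, hα⟩
  -- `f` must vary, since the induction hypothesis is applied to the rescaled family `F t`.
  induction S using Finset.strongInduction generalizing f x with
  | H S ih =>
    have key : ∀ i ∈ S, Real.cos α * ∑ a, ‖faceSum (S.erase i) (fun y => Complex.exp (∑ j, f j y))
        (Function.update x i a)‖ ≤ ‖faceSum S (fun y => Complex.exp (∑ j, f j y)) x‖ := by
      intro i hi
      rw [faceSum_eq_sum_erase hi]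
      set A : (ι → Ω) → ℂ := fun y => ∑ j with ¬ i ∈ I j, f j y with hA
      set B : (ι → Ω) → ℂ := fun y => ∑ j with i ∈ I j, f j y with hB
      let F : ℝ → J → (ι → Ω) → ℂ := fun t j y => if i ∈ I j then (t : ℂ) * f j y else f j y
      have hF : ∀ t y, ∑ j, F t j y = A y + t * B y := by
        intro t y
        simp only [F, hA, hB, Finset.sum_ite, Finset.mul_sum]
        exact add_comm _ _
      have hFd : ∀ t j, DependsOn (F t j) (I j) := by
        intro t j y z hyz
        simp only [F, hf j hyz]
      have hFρ : ∀ t ∈ Set.Icc (0 : ℝ) 1, ∀ j y, ‖F t j y‖ ≤ ρ j := by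
        intro t ht j y
        simp only [F]
        split_ifs
        · rw [norm_mul, Complex.norm_real, Real.norm_of_nonneg ht.1]
          calc t * ‖f j y‖ ≤ 1 * ‖f j y‖ := by gcongr; exact ht.2
            _ ≤ ρ j := by rw [one_mul]; exact hfρ j y
        · exact hfρ j y
      have hne : ∀ t ∈ Set.Icc (0 : ℝ) 1, ∀ z,
          faceSum (S.erase i) (fun y => Complex.exp (A y + t * B y)) z ≠ 0 := by
        intro t ht z
        have := (ih (S.erase i) (Finset.erase_ssubset hi) (F t) (hFd t) (hFρ t ht) z).1
        simpa only [hF] using this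
      have hsplit : ∀ t ∈ Set.Icc (0 : ℝ) 1, ∀ T ⊆ S.erase i, ∀ k ∈ T, ∀ z : ι → Ω,
          Real.cos α * ∑ a, ‖faceSum (T.erase k) (fun y => Complex.exp (A y + t * B y))
            (Function.update z k a)‖ ≤ ‖faceSum T (fun y => Complex.exp (A y + t * B y)) z‖ := by
        intro t ht T hT k hk z
        have := (ih T (hT.trans_ssubset (Finset.erase_ssubset hi)) (F t) (hFd t) (hFρ t ht) z).2 k hk
        simpa only [hF] using this
      have hbound : ∀ t ∈ Set.Icc (0 : ℝ) 1, ∀ z,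
          ‖faceSum (S.erase i) (fun y => B y * Complex.exp (A y + t * B y)) z‖ ≤
            α * ‖faceSum (S.erase i) (fun y => Complex.exp (A y + t * B y)) z‖ := by
        intro t ht z
        simp only [hB, Finset.sum_mul]
        rw [faceSum_sum]
        refine (norm_sum_le _ _).trans ?_
        calc _ ≤ ∑ j with i ∈ I j, ρ j * ((Real.cos α ^ (c - 1))⁻¹ *
              ‖faceSum (S.erase i) (fun y => Complex.exp (A y + t * B y)) z‖) := by
              refine Finset.sum_le_sum fun j hj => ?_
              have hij : i ∈ I j := (Finset.mem_filter.1 hj).2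
              refine (norm_faceSum_mul_le hC (hρ j) (hf j) (hfρ j) (S.erase i)
                (hsplit t ht) z).trans ?_
              rw [mul_assoc]
              -- The exponent is `c - 1` because `i` lies in `I j` but is no longer free.
              have hcard : (I j ∩ S.erase i).card ≤ c - 1 := by
                have h1 : I j ∩ S.erase i ⊆ (I j).erase i := by
                  intro k hk
                  simp only [Finset.mem_inter, Finset.mem_erase] at hk ⊢
                  exact ⟨hk.2.1, hk.1⟩
                have h2 := Finset.card_le_card h1
                rw [Finset.card_erase_of_mem hij] at h2
                have := hI j
                omega
              have hpow : Real.cos α ^ (c - 1) ≤ Real.cos α ^ (I j ∩ S.erase i).card :=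
                pow_le_pow_of_le_one hC.le (Real.cos_le_one α) hcard
              gcongr
              exact hρ j
          _ = (∑ j with i ∈ I j, ρ j) * (Real.cos α ^ (c - 1))⁻¹ *
              ‖faceSum (S.erase i) (fun y => Complex.exp (A y + t * B y)) z‖ := by
              rw [← Finset.sum_mul, mul_assoc]
          _ ≤ _ := by
              gcongr
              rw [← div_eq_mul_inv, div_le_iff₀ (pow_pos hC _)]
              exact (hL i).trans hLα
      have hfAB : ∀ y, ∑ j, f j y = A y + ((1 : ℝ) : ℂ) * B y := by
        intro y
        rw [← hF 1 y]
        simp [F]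
      simp only [hfAB]
      have hA0 : DependsOn (fun y => Complex.exp (A y + ((0 : ℝ) : ℂ) * B y)) {i}ᶜ := by
        intro y z hyz
        simp only [hA, Complex.ofReal_zero, zero_mul, add_zero]
        congr 1
        refine Finset.sum_congr rfl fun j hj => hf j fun k hk => hyz k ?_
        rintro rfl
        exact (Finset.mem_filter.1 hj).2 hk
      refine cos_mul_sum_norm_le_norm_sum (hne 0 (by simp) x) fun a => ?_
      rw [← faceSum_update_of_dependsOn (Finset.notMem_erase i S) hA0 x a]
      refine cos_mul_norm_mul_norm_le_re_of_norm_deriv_le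
        (φ := fun t : ℝ => faceSum (S.erase i) (fun y => Complex.exp (A y + t * B y))
          (Function.update x i a))
        (φ' := fun t : ℝ => faceSum (S.erase i) (fun y => B y * Complex.exp (A y + t * B y))
          (Function.update x i a)) (by linarith [Real.pi_pos]) ?_ ?_
        (fun t ht => hne t ht _) (fun t ht => hbound t ht _)
      · intro t
        refine HasDerivAt.fun_sum fun y _ => ?_
        have h1 : HasDerivAt (fun t : ℝ => A y + (t : ℂ) * B y) (B y) t := by
          simpa using ((Complex.ofRealCLM.hasDerivAt (x := t)).mul_const (B y)).const_add (A y)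
        simpa [mul_comm] using h1.cexp
      · unfold faceSum
        fun_prop
    refine ⟨?_, key⟩
    rcases S.eq_empty_or_nonempty with rfl | ⟨i, hi⟩
    · rw [faceSum_empty]
      exact Complex.exp_ne_zero _
    · refine norm_pos_iff.1 (lt_of_lt_of_le (mul_pos hC ?_) (key i hi))
      exact Finset.sum_pos (fun a _ => norm_pos_iff.2
        (ih _ (Finset.erase_ssubset hi) f hf hfρ _).1) Finset.univ_nonempty

/-- A sum over a product space of a product of functions `1 + g j`, where each `g j` is small and
depends on at most `c` coordinates and each coordinate is involved in at most `r` of the `g j`,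
does not vanish. -/
theorem sum_prod_one_add_ne_zero [Nonempty Ω] {I : J → Finset ι} {r c : ℕ} (hr : 2 ≤ r)
    (hc : 1 ≤ c) (hIc : ∀ j, (I j).card ≤ c)
    (hIr : ∀ i, (Finset.univ.filter fun j => i ∈ I j).card ≤ r) {g : J → (ι → Ω) → ℂ}
    (hg : ∀ j, DependsOn (g j) (I j))
    (hgb : ∀ j y, ‖g j y‖ ≤ 0.46 / ((r : ℝ) * Real.sqrt c)) :
    ∑ y, ∏ j, (1 + g j y) ≠ 0 := by
  have hr' : (2 : ℝ) ≤ r := by exact_mod_cast hr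
  have hc' : (1 : ℝ) ≤ c := by exact_mod_cast hc
  have hs : 1 ≤ Real.sqrt c := Real.one_le_sqrt.2 hc'
  have hs2 : Real.sqrt c ^ 2 = c := Real.sq_sqrt (by linarith)
  set s := Real.sqrt c
  have hs0 : 0 < s := by linarith
  set ε : ℝ := 0.46 / ((r : ℝ) * s) with hε
  have hε0 : 0 < ε := by positivity
  have hε1 : ε ≤ 0.23 := by
    rw [hε, div_le_iff₀ (by positivity)]
    nlinarith
  have hg1 : ∀ j y, ‖g j y‖ < 1 := fun j y => by linarith [hgb j y]
  -- From $|\log(1+g)|\le|g|+|g|^2/(2(1-|g|))$ and $|g|\le0.23$, as $1+0.23\cdot1.3/2<1.15$.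
  have hlog : ∀ j y, ‖Complex.log (1 + g j y)‖ ≤ 1.15 * ε := by
    intro j y
    refine (Complex.norm_log_one_add_le (hg1 j y)).trans ?_
    have h0 := norm_nonneg (g j y)
    have h1 := hgb j y
    have h2 : (1 - ‖g j y‖)⁻¹ ≤ 1.3 := by
      rw [inv_le_comm₀ (by linarith) (by norm_num)]
      norm_num
      linarith
    have h3 : ‖g j y‖ ^ 2 * (1 - ‖g j y‖)⁻¹ ≤ ‖g j y‖ ^ 2 * 1.3 := by gcongr
    nlinarith
  have hexp : ∀ y, ∏ j, (1 + g j y) = Complex.exp (∑ j, Complex.log (1 + g j y)) := by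
    intro y
    rw [Complex.exp_sum]
    refine Finset.prod_congr rfl fun j _ => (Complex.exp_log ?_).symm
    intro h
    have h1 := hg1 j y
    rw [show g j y = -1 by linear_combination h] at h1
    simp at h1
  set α : ℝ := 0.8 / s with hαdef
  have hα0 : 0 ≤ α := by positivity
  have hα1 : α ≤ 0.8 := div_le_self (by norm_num) hs
  have hα2 : α ^ 2 = 0.64 / c := by
    rw [hαdef, div_pow, hs2]
    norm_num
  -- Bernoulli with $\cos\alpha\ge1-\alpha^2/2$ gives $1-c\alpha^2/2=0.68$. This suffices because
  -- $0.46\cdot1.15=0.529\le0.8\cdot0.68=0.544$.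
  have hcospow : 0.68 ≤ Real.cos α ^ (c - 1) := by
    have h1 : 1 + (-(α ^ 2 / 2)) ≤ Real.cos α := by linarith [Real.one_sub_sq_div_two_le_cos (x := α)]
    have h2 : 0 ≤ 1 + (-(α ^ 2 / 2)) := by nlinarith
    have h3 := one_add_mul_le_pow (a := -(α ^ 2 / 2)) (by nlinarith) (c - 1)
    have h4 : 1 + ((c - 1 : ℕ) : ℝ) * (-(α ^ 2 / 2)) ≥ 0.68 := by
      have h5 : ((c - 1 : ℕ) : ℝ) ≤ c := by exact_mod_cast Nat.sub_le c 1
      have h6 : (c : ℝ) * α ^ 2 = 0.64 := by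
        rw [hα2]
        field_simp
      nlinarith [mul_le_mul_of_nonneg_right h5 (sq_nonneg α)]
    linarith [pow_le_pow_left₀ h2 h1 (c - 1)]
  have main := (faceSum_exp_ne_zero (Ω := Ω) (I := I) (ρ := fun _ => 1.15 * ε) (c := c) (α := α)
    (L := r * (1.15 * ε)) (by linarith [Real.pi_gt_three]) hα0 hIc ?_ ?_ (fun _ => by positivity)
    Finset.univ (fun j y => Complex.log (1 + g j y)) (fun j y z hyz => by simp only [hg j hyz])
    hlog (fun _ => Classical.arbitrary Ω)).1
  · rw [faceSum_univ] at main
    simpa only [hexp] using main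
  · intro i
    rw [Finset.sum_const, nsmul_eq_mul]
    gcongr
    exact hIr i
  · calc (r : ℝ) * (1.15 * ε) = 0.529 / s := by
          rw [hε]
          field_simp
          norm_num
      _ ≤ 0.8 / s * 0.68 := by
          rw [div_mul_eq_mul_div]
          gcongr
          norm_num
      _ ≤ α * Real.cos α ^ (c - 1) := by gcongr

end NonVanishing

/-! ### Fourier expansion of the weight -/

theorem AddChar.map_sum_eq_prod_map {ι G M : Type*} [AddCommMonoid G] [CommMonoid M]
    (ψ : AddChar G M) (s : Finset ι) (a : ι → G) : ψ (∑ i ∈ s, a i) = ∏ i ∈ s, ψ (a i) :=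
  map_prod ψ.toMonoidHom (fun i => Multiplicative.ofAdd (a i)) s

/-- Orthogonality of characters in each coordinate; it detects the equations defining the solution
set. -/
theorem sum_prod_stdAddChar {κ m : ℕ} [NeZero κ] (y : Fin m → ZMod κ) :
    ∑ l : Fin m → ZMod κ, ∏ i, (ZMod.stdAddChar (l i * y i) : ℂ) =
      if ∀ i, y i = 0 then (κ : ℂ) ^ m else 0 := by
  have h := Finset.prod_univ_sum (fun _ : Fin m => (Finset.univ : Finset (ZMod κ)))
    (fun i a => (ZMod.stdAddChar (a * y i) : ℂ))
  rw [Fintype.piFinset_univ] at h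
  rw [← h]
  simp only [AddChar.sum_mulShift _ (ZMod.isPrimitive_stdAddChar κ), ZMod.card]
  split_ifs with hy
  · simp [hy]
  · push Not at hy
    obtain ⟨i, hi⟩ := hy
    exact Finset.prod_eq_zero (Finset.mem_univ i) (by simp [hi])

theorem vecWeight_eq_prod {κ n : ℕ} (w : Fin n → ℂ) (x : Fin n → ZMod κ) :
    vecWeight w x = ∏ j, if x j = 0 then 1 else w j := by
  rw [vecWeight, Finset.prod_filter]
  exact Finset.prod_congr rfl fun j _ => by simp only [ne_eq, ite_not]

theorem setWeight_eq_sum {κ n : ℕ} [NeZero κ] (w : Fin n → ℂ) (X : Set (Fin n → ZMod κ))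
    [DecidablePred (· ∈ X)] : setWeight w X = ∑ x, if x ∈ X then vecWeight w x else 0 := by
  rw [setWeight, finsum_mem_def, finsum_eq_sum_of_fintype]
  exact Finset.sum_congr rfl fun x _ => by simp [Set.indicator_apply]

/-- The weight of the solution set as a sum over the dual group. -/
theorem pow_mul_setWeight_solutionSet {κ m n : ℕ} [NeZero κ] (A : Matrix (Fin m) (Fin n) ℤ)
    (w : Fin n → ℂ) :
    (κ : ℂ) ^ m * setWeight w (solutionSet κ A) =
      ∑ l : Fin m → ZMod κ, ∏ j, (1 + w j * ∑ a with a ≠ (0 : ZMod κ),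
        (ZMod.stdAddChar (a * ∑ i, l i * (A i j : ZMod κ)) : ℂ)) := by
  classical
  have hfactor : ∀ (l : Fin m → ZMod κ) (j : Fin n),
      1 + w j * ∑ a with a ≠ (0 : ZMod κ),
        (ZMod.stdAddChar (a * ∑ i, l i * (A i j : ZMod κ)) : ℂ) =
      ∑ a : ZMod κ, (if a = 0 then 1 else w j) *
        (ZMod.stdAddChar (a * ∑ i, l i * (A i j : ZMod κ)) : ℂ) := by
    intro l j
    rw [← Finset.sum_filter_add_sum_filter_not Finset.univ (fun a : ZMod κ => a = 0),
      Finset.mul_sum]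
    congr 1
    · rw [Finset.filter_eq' Finset.univ (0 : ZMod κ)]
      simp
    · exact Finset.sum_congr rfl fun a ha => by rw [if_neg (Finset.mem_filter.1 ha).2]
  have hexpand : ∀ l : Fin m → ZMod κ,
      ∏ j, ∑ a : ZMod κ, (if a = 0 then 1 else w j) *
        (ZMod.stdAddChar (a * ∑ i, l i * (A i j : ZMod κ)) : ℂ) =
      ∑ x : Fin n → ZMod κ, vecWeight w x *
        ∏ i, (ZMod.stdAddChar (l i * ∑ j, (A i j : ZMod κ) * x j) : ℂ) := by
    intro l
    rw [Finset.prod_univ_sum, Fintype.piFinset_univ]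
    refine Finset.sum_congr rfl fun x _ => ?_
    rw [Finset.prod_mul_distrib, ← vecWeight_eq_prod, ← AddChar.map_sum_eq_prod_map,
      ← AddChar.map_sum_eq_prod_map]
    congr 2
    simp only [Finset.mul_sum]
    rw [Finset.sum_comm]
    exact Finset.sum_congr rfl fun i _ => Finset.sum_congr rfl fun j _ => by ring
  simp only [hfactor, hexpand]
  rw [Finset.sum_comm, setWeight_eq_sum, Finset.mul_sum]
  refine Finset.sum_congr rfl fun x _ => ?_
  rw [← Finset.mul_sum, sum_prod_stdAddChar]
  have : (x ∈ solutionSet κ A) = ∀ i, ∑ j, (A i j : ZMod κ) * x j = 0 := rfl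
  simp only [this]
  split_ifs
  · ring
  · simp

theorem setWeight_solutionSet_ne_zero {κ : ℕ} (hκ : 1 < κ) {m n : ℕ}
    (A : Matrix (Fin m) (Fin n) ℤ) {r c : ℕ} (hr : 2 ≤ r) (hc : 1 ≤ c) (hAr : RowSparse A r)
    (hAc : ColSparse A c) {w : Fin n → ℂ}
    (hw : ∀ j, ‖w j‖ ≤ 0.46 / (((κ : ℝ) - 1) * (r : ℝ) * Real.sqrt (c : ℝ))) :
    setWeight w (solutionSet κ A) ≠ 0 := by
  classical
  have : NeZero κ := ⟨by omega⟩
  refine right_ne_zero_of_mul (a := (κ : ℂ) ^ m) ?_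
  rw [pow_mul_setWeight_solutionSet]
  refine sum_prod_one_add_ne_zero (I := fun j => Finset.univ.filter fun i => A i j ≠ 0) hr hc
    (fun j => ?_) (fun i => ?_) (fun j y z hyz => ?_) (fun j y => ?_)
  · have := hAc j
    rwa [Set.ncard_eq_toFinset_card', Set.toFinset_ofPred] at this
  · have := hAr i
    rw [Set.ncard_eq_toFinset_card', Set.toFinset_ofPred] at this
    simpa using this
  · have : ∑ i, y i * (A i j : ZMod κ) = ∑ i, z i * (A i j : ZMod κ) := by
      refine Finset.sum_congr rfl fun i _ => ?_
      by_cases h : A i j = 0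
      · simp [h]
      · rw [hyz i (by simpa using h)]
    simp only [this]
  · have hκ' : (0 : ℝ) < (κ : ℝ) - 1 := by
      have : (1 : ℝ) < κ := by exact_mod_cast hκ
      linarith
    -- There are `κ - 1` terms of norm 1, which cancels the `κ - 1` in the bound on `w j`.
    have hsum : ‖∑ a with a ≠ (0 : ZMod κ),
        (ZMod.stdAddChar (a * ∑ i, y i * (A i j : ZMod κ)) : ℂ)‖ ≤ (κ : ℝ) - 1 := by
      refine (norm_sum_le _ _).trans ?_
      simp only [AddChar.norm_apply, Finset.sum_const, nsmul_eq_mul, mul_one]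
      rw [Finset.filter_ne', Finset.card_erase_of_mem (Finset.mem_univ _), Finset.card_univ,
        ZMod.card, Nat.cast_sub hκ.le, Nat.cast_one]
    rw [norm_mul]
    calc ‖w j‖ * _ ≤ 0.46 / (((κ : ℝ) - 1) * (r : ℝ) * Real.sqrt (c : ℝ)) * ((κ : ℝ) - 1) := by
          gcongr
          exact hw j
      _ = 0.46 / ((r : ℝ) * Real.sqrt c) := by
          have : (r : ℝ) ≠ 0 := by positivity
          have : Real.sqrt c ≠ 0 := (Real.sqrt_pos.2 (by exact_mod_cast hc)).ne'
          field_simp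

/-! ### Weight enumerators of codes -/

theorem setWeight_const_eq_eval_weightEnumerator {p n : ℕ} [NeZero p] {X : Set (Fin n → ZMod p)}
    (h0 : (0 : Fin n → ZMod p) ∈ X) (z : ℂ) :
    setWeight (fun _ => z) X = (weightEnumerator X).eval z := by
  classical
  have hvec : ∀ x : Fin n → ZMod p, vecWeight (fun _ => z) x = z ^ hammingNorm x := by
    intro x
    rw [vecWeight, Finset.prod_const, hammingNorm]
  have hcount : ∀ k, ∑ x with x ∈ X ∧ hammingNorm x = k, z ^ hammingNorm x =
      ({x | x ∈ X ∧ hammingNorm x = k}.ncard : ℂ) * z ^ k := by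
    intro k
    rw [Finset.sum_congr rfl (g := fun _ => z ^ k)
      fun x hx => by rw [(Finset.mem_filter.1 hx).2.2], Finset.sum_const, nsmul_eq_mul,
      Set.ncard_eq_toFinset_card', Set.toFinset_ofPred]
  have hzero : {x : Fin n → ZMod p | x ∈ X ∧ hammingNorm x = 0} = {0} := by
    ext x
    simp only [Set.mem_ofPred_eq, hammingNorm_eq_zero, Set.mem_singleton_iff]
    exact ⟨fun h => h.2, fun h => ⟨h ▸ h0, h⟩⟩
  rw [setWeight_eq_sum, ← Finset.sum_filter]
  simp only [hvec]
  rw [← Finset.sum_fiberwise_of_maps_to (t := Finset.range (n + 1)) (g := hammingNorm)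
    fun (x : Fin n → ZMod p) _ => Finset.mem_range.2 (Nat.lt_succ_of_le (by
      simpa using hammingNorm_le_card_fintype (x := x)))]
  simp only [Finset.filter_filter, hcount]
  -- The zero vector alone has Hamming norm 0 and gives the constant term 1.
  rw [Finset.sum_range_eq_add_Ico _ (Nat.succ_pos n), hzero, weightEnumerator]
  simp only [Polynomial.eval_add, Polynomial.eval_one, Polynomial.eval_finsetSum,
    Polynomial.eval_mul, Polynomial.eval_C, Polynomial.eval_pow, Polynomial.eval_X,
    Set.ncard_singleton, Nat.cast_one, pow_zero, mul_one]
  rfl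

/-- A parity check code as the solution set of an integer system. -/
theorem parityCheckCode_eq_solutionSet {p m n : ℕ} [NeZero p] (A : Matrix (Fin m) (Fin n) (ZMod p)) :
    (parityCheckCode A : Set (Fin n → ZMod p)) =
      solutionSet p (A.map fun a => (a.val : ℤ)) := by
  ext x
  simp [parityCheckCode, solutionSet, funext_iff, Matrix.mulVec, dotProduct]

theorem theorem1p6 :
    (∀ (κ : ℕ), 1 < κ → ∀ (m n : ℕ) (A : Matrix (Fin m) (Fin n) ℤ) (r c : ℕ), 2 ≤ r → 1 ≤ c →
      RowSparse A r → ColSparse A c → ∀ w : Fin n → ℂ,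
      (∀ j, ‖w j‖ ≤ 0.46 / (((κ : ℝ) - 1) * (r : ℝ) * Real.sqrt (c : ℝ))) →
      setWeight w (solutionSet κ A) ≠ 0) ∧
    (∀ (p : ℕ), p.Prime → ∀ (m n : ℕ) (A : Matrix (Fin m) (Fin n) (ZMod p)) (r c : ℕ),
      2 ≤ r → 1 ≤ c → RowSparse A r → ColSparse A c → ∀ z : ℂ,
      ‖z‖ ≤ 0.46 / (((p : ℝ) - 1) * (r : ℝ) * Real.sqrt (c : ℝ)) →
      (weightEnumerator (parityCheckCode A : Set (Fin n → ZMod p))).eval z ≠ 0) := by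
  refine ⟨fun κ hκ m n A r c hr hc hAr hAc w hw =>
    setWeight_solutionSet_ne_zero hκ A hr hc hAr hAc hw, ?_⟩
  intro p hp m n A r c hr hc hAr hAc z hz
  have : NeZero p := ⟨hp.ne_zero⟩
  rw [← setWeight_const_eq_eval_weightEnumerator (parityCheckCode A).zero_mem,
    parityCheckCode_eq_solutionSet]
  refine setWeight_solutionSet_ne_zero hp.one_lt _ hr hc ?_ ?_ fun _ => hz
  · simpa only [RowSparse, Matrix.map_apply, ne_eq, Nat.cast_eq_zero, ZMod.val_eq_zero] using hAr
  · simpa only [ColSparse, Matrix.map_apply, ne_eq, Nat.cast_eq_zero, ZMod.val_eq_zero] using hAc
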